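/- Let $\zeta$ be the Riemann zeta function and $\eta(s)=(1-2^{1-s})\zeta(s)$ the Dirichlet eta function, with $\eta(1)=\log 2$ (so $\eta(s)=\sum_{n\ge 1}(-1)^{n+1}n^{-s}$ for $s>0$, and $\eta(0)=\tfrac12$). For real $a,b$ with $a+b\neq 0$ let $H(a,b)=\frac{2ab}{a+b}$. 1. The function $1/\zeta$ is strictly concave on $(0,1)$. 2. For all $x\in(0,1)$, $$\zeta(1/2)\le H(\zeta(x),\zeta(1-x))<-1,$$ with equality on the left if and only if $x=1/2$. Moreover $H(\zeta(x),\zeta(1-x))\to-1$ as $x\to0^+$ and as $x\to1^-$; thus the continuous extension of $x\mapsto H(\zeta(x),\zeta(1-x))$ to $[0,1]$ takes the value $-1$ exactly at $x\in\{0,1\}$ and the value $\zeta(1/2)$ exactly at $x=1/2$. 3. For all $x\in[0,1]$, $$\frac{\log 4}{1+\log 4}\le H(\eta(x),\eta(1-x))\le(1-\sqrt2)\,\zeta(1/2),$$ with equality on the left if and only if $x\in\{0,1\}$, and equality on the right if and only if $x=1/2$. -/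

import Mathlib

namespace HarmonicMeanZeta

open Filter Topology

/-- The harmonic mean `H(a, b) = 2ab / (a + b)` of two real numbers. -/
noncomputable def H (a b : ℝ) : ℝ := 2 * a * b / (a + b)

/-- The Riemann zeta function on the real line (it is real there, see `ofReal_zeta`). -/
noncomputable def zeta (x : ℝ) : ℝ := (riemannZeta (x : ℂ)).re

/-- The Dirichlet eta function on the real line: `η(x) = (1 - 2^(1-x)) ζ(x)`, where the removable
singularity at `x = 1` is filled with the value `log 2`. For `x > 0` it is the sum of the
alternating series `∑ (-1)^(n+1) / n^x`, see `tendsto_eta`. -/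
noncomputable def eta (x : ℝ) : ℝ :=
  if x = 1 then Real.log 2 else (1 - (2 : ℝ) ^ (1 - x)) * zeta x

theorem ofReal_zeta (x : ℝ) : ((zeta x : ℝ) : ℂ) = riemannZeta (x : ℂ) := by
  have h := riemannZeta_conj (x : ℂ)
  rw [Complex.conj_ofReal] at h
  exact (Complex.conj_eq_iff_re.mp h.symm)

/-- The grouped terms of the alternating series. -/
noncomputable def pairTerm (k : ℕ) (s : ℂ) : ℂ :=
  (((2 * k + 1 : ℝ)) : ℂ) ^ (-s) - (((2 * k + 1 + 1 : ℝ)) : ℂ) ^ (-s)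

theorem norm_cpow_sub_le {x : ℝ} (hx : 0 < x) {s : ℂ} (hs : 0 < s.re) :
    ‖(x : ℂ) ^ (-s) - (((x + 1 : ℝ)) : ℂ) ^ (-s)‖ ≤ ‖s‖ * x ^ (-s.re - 1) := by
  have hs0 : -s ≠ 0 := by
    intro h
    have := congrArg Complex.re h
    simp at this
    linarith
  have := (convex_Icc x (x + 1)).norm_image_sub_le_of_norm_hasDerivWithin_le
    (f := fun y : ℝ => (y : ℂ) ^ (-s)) (f' := fun y : ℝ => -s * (y : ℂ) ^ (-s - 1))
    (C := ‖s‖ * x ^ (-s.re - 1)) (x := x + 1) (y := x)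
    (fun y hy => (hasDerivAt_ofReal_cpow_const (hx.trans_le hy.1).ne' hs0).hasDerivWithinAt)
    (fun y hy => by
      have hy0 : 0 < y := hx.trans_le hy.1
      rw [norm_mul, norm_neg, Complex.norm_cpow_eq_rpow_re_of_pos hy0]
      gcongr
      simp only [Complex.sub_re, Complex.neg_re, Complex.one_re]
      exact Real.rpow_le_rpow_of_nonpos hx hy.1 (by linarith))
    (by simp) (by simp)
  simpa using this

theorem norm_pairTerm_le (k : ℕ) {s : ℂ} {d R : ℝ} (hd : 0 < d) (hs : d < s.re) (hR : ‖s‖ < R) :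
    ‖pairTerm k s‖ ≤ R * ((k + 1 : ℕ) : ℝ) ^ (-d - 1) := by
  have hk : (0 : ℝ) ≤ k := Nat.cast_nonneg k
  refine (norm_cpow_sub_le (x := 2 * k + 1) (by positivity) (hd.trans hs)).trans ?_
  have h1 : (2 * k + 1 : ℝ) ^ (-s.re - 1) ≤ (2 * k + 1 : ℝ) ^ (-d - 1) :=
    Real.rpow_le_rpow_of_exponent_le (by linarith) (by linarith)
  have h2 : (2 * k + 1 : ℝ) ^ (-d - 1) ≤ ((k + 1 : ℕ) : ℝ) ^ (-d - 1) :=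
    Real.rpow_le_rpow_of_nonpos (by positivity) (by push_cast; linarith) (by linarith)
  have hR0 : 0 ≤ R := (norm_nonneg s).trans hR.le
  gcongr
  exact h1.trans h2

theorem summable_bound {d : ℝ} (hd : 0 < d) (R : ℝ) :
    Summable fun k : ℕ => R * ((k + 1 : ℕ) : ℝ) ^ (-d - 1) :=
  ((summable_nat_add_iff 1).mpr (Real.summable_nat_rpow.mpr (by linarith))).mul_left R

theorem summable_pairTerm {s : ℂ} (hs : 0 < s.re) : Summable fun k => pairTerm k s :=
  Summable.of_norm_bounded (summable_bound (half_pos hs) (‖s‖ + 1))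
    fun k => norm_pairTerm_le k (half_pos hs) (by linarith) (by linarith)

theorem differentiableAt_tsum_pairTerm {s : ℂ} (hs : 0 < s.re) :
    DifferentiableAt ℂ (fun z => ∑' k, pairTerm k z) s := by
  set U : Set ℂ := {z | s.re / 2 < z.re} ∩ {z | ‖z‖ < ‖s‖ + 1} with hUdef
  have hU : IsOpen U := (isOpen_lt continuous_const Complex.continuous_re).inter
    (isOpen_lt continuous_norm continuous_const)
  have hsU : s ∈ U := ⟨show s.re / 2 < s.re by linarith, by simp⟩
  refine (Complex.differentiableOn_tsum_of_summable_norm (summable_bound (half_pos hs) (‖s‖ + 1))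
    (fun k => ?_) hU (fun k z hz => norm_pairTerm_le k (half_pos hs) hz.1 hz.2)).differentiableAt
    (hU.mem_nhds hsU)
  intro z _
  have h1 : (((2 * k + 1 : ℝ)) : ℂ) ≠ 0 := by
    exact_mod_cast (by positivity : (2 * k + 1 : ℝ) ≠ 0)
  have h2 : (((2 * k + 1 + 1 : ℝ)) : ℂ) ≠ 0 := by
    exact_mod_cast (by positivity : (2 * k + 1 + 1 : ℝ) ≠ 0)
  exact ((differentiableAt_id.neg.const_cpow (.inl h1)).sub
    (differentiableAt_id.neg.const_cpow (.inl h2))).differentiableWithinAt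

theorem sum_pairTerm (s : ℂ) (m : ℕ) :
    ∑ k ∈ Finset.range m, pairTerm k s =
      ∑ n ∈ Finset.range (2 * m), (-1 : ℂ) ^ n * ((n : ℂ) + 1) ^ (-s) := by
  induction m with
  | zero => simp
  | succ m ih =>
    rw [Finset.sum_range_succ, ih, show 2 * (m + 1) = 2 * m + 1 + 1 by ring,
      Finset.sum_range_succ, Finset.sum_range_succ, pairTerm, pow_succ, pow_mul]
    push_cast
    ring

theorem tsum_pairTerm_of_one_lt {s : ℂ} (hs : 1 < s.re) :
    ∑' k, pairTerm k s = (1 - (2 : ℂ) ^ (1 - s)) * riemannZeta s := by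
  have hs0 : s ≠ 0 := Complex.ne_zero_of_one_lt_re hs
  have hZ : HasSum (fun n : ℕ => ((n : ℂ) + 1) ^ (-s)) (riemannZeta s) := by
    rw [zeta_eq_tsum_one_div_nat_add_one_cpow hs]
    have h : Summable fun n : ℕ => 1 / ((n : ℂ) + 1) ^ s := by
      have := (summable_nat_add_iff 1).mpr (Complex.summable_one_div_nat_cpow.mpr hs)
      simpa using this
    simpa [Complex.cpow_neg] using h.hasSum
  have hodd : Tendsto (fun m : ℕ => ∑ k ∈ Finset.range m, (2 * (k : ℂ) + 1 + 1) ^ (-s)) atTop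
      (𝓝 ((2 : ℂ) ^ (-s) * riemannZeta s)) := by
    have := (hZ.mul_left ((2 : ℂ) ^ (-s))).tendsto_sum_nat
    refine this.congr fun m => Finset.sum_congr rfl fun k _ => ?_
    have h := Complex.mul_cpow_ofReal_nonneg (a := 2) (b := (k : ℝ) + 1) (by norm_num)
      (by positivity) (-s)
    push_cast at h
    rw [← h]
    congr 1
    ring
  have hfull := hZ.tendsto_sum_nat.comp (tendsto_id.const_mul_atTop' (r := 2) (by norm_num))
  have key := hfull.sub (hodd.const_mul 2)
  have h2 : (2 : ℂ) ^ (1 - s) = 2 * (2 : ℂ) ^ (-s) := by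
    rw [sub_eq_add_neg, Complex.cpow_add _ _ two_ne_zero, Complex.cpow_one]
  refine tendsto_nhds_unique
    (summable_pairTerm (zero_lt_one.trans hs)).hasSum.tendsto_sum_nat ?_
  rw [h2, show (1 - 2 * (2 : ℂ) ^ (-s)) * riemannZeta s
    = riemannZeta s - 2 * ((2 : ℂ) ^ (-s) * riemannZeta s) by ring]
  refine key.congr fun m => ?_
  simp only [Function.comp_apply, id]
  induction m with
  | zero => simp
  | succ m ih =>
    rw [Finset.sum_range_succ (fun k => pairTerm k s) m, ← ih,
      show 2 * (m + 1) = 2 * m + 1 + 1 by ring, Finset.sum_range_succ, Finset.sum_range_succ,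
      Finset.sum_range_succ _ m, pairTerm]
    push_cast
    ring

theorem tsum_pairTerm {s : ℂ} (hs : 0 < s.re) (hs1 : s ≠ 1) :
    ∑' k, pairTerm k s = (1 - (2 : ℂ) ^ (1 - s)) * riemannZeta s := by
  -- multiply by `s - 1` to work on a half plane, which is convex
  have hopen : IsOpen {z : ℂ | 0 < z.re} := isOpen_lt continuous_const Complex.continuous_re
  set g : ℂ → ℂ := Function.update (fun z => (z - 1) * riemannZeta z) 1 1 with hg
  have hgd : Differentiable ℂ g := by
    have hoff : DifferentiableOn ℂ g ({1}ᶜ : Set ℂ) := by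
      intro z hz
      have hd : DifferentiableAt ℂ (fun z => (z - 1) * riemannZeta z) z :=
        (differentiableAt_id.sub_const 1).mul (differentiableAt_riemannZeta hz)
      refine (hd.congr_of_eventuallyEq ?_).differentiableWithinAt
      filter_upwards [isOpen_compl_singleton.mem_nhds hz] with w hw
      exact Function.update_of_ne hw _ _
    have hcont : ContinuousAt g 1 := by
      rw [hg, continuousAt_update_same]
      exact riemannZeta_residue_one
    have := (Complex.differentiableOn_compl_singleton_and_continuousAt_iff
      (s := Set.univ) (c := (1 : ℂ)) (f := g) univ_mem).mp
      ⟨by rwa [← Set.compl_eq_univ_sdiff], hcont⟩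
    exact differentiableOn_univ.mp this
  have hF : AnalyticOnNhd ℂ (fun z => (z - 1) * ∑' k, pairTerm k z) {z : ℂ | 0 < z.re} :=
    DifferentiableOn.analyticOnNhd (fun z hz => ((differentiableAt_id.sub_const 1).mul
      (differentiableAt_tsum_pairTerm hz)).differentiableWithinAt) hopen
  have hG : AnalyticOnNhd ℂ (fun z => (1 - (2 : ℂ) ^ (1 - z)) * g z) {z : ℂ | 0 < z.re} :=
    DifferentiableOn.analyticOnNhd (fun z _ => (((differentiableAt_const 1).sub
      ((differentiableAt_id.const_sub 1).const_cpow (.inl two_ne_zero))).mul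
      (hgd z)).differentiableWithinAt) hopen
  have h2 : (2 : ℂ) ∈ {z : ℂ | 0 < z.re} := by simp
  have heq := hF.eqOn_of_preconnected_of_eventuallyEq hG
    (convex_halfSpace_re_gt 0).isPreconnected h2 (by
      filter_upwards [(isOpen_lt continuous_const Complex.continuous_re).mem_nhds
        (show (1 : ℝ) < (2 : ℂ).re by simp)] with z hz
      have hz1 : z ≠ 1 := by rintro rfl; simp at hz
      rw [tsum_pairTerm_of_one_lt hz, hg, Function.update_of_ne hz1]
      ring)
  have := heq hs
  simp only [hg, Function.update_of_ne hs1] at this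
  refine mul_left_cancel₀ (sub_ne_zero.mpr hs1) ?_
  rw [this]
  ring

theorem tsum_pairTerm_one : ∑' k, pairTerm k 1 = (Real.log 2 : ℂ) := by
  have hcont : Tendsto (fun z => ∑' k, pairTerm k z) (𝓝[≠] (1 : ℂ)) (𝓝 (∑' k, pairTerm k 1)) :=
    (differentiableAt_tsum_pairTerm (s := 1) (by simp)).continuousAt.tendsto.mono_left
      nhdsWithin_le_nhds
  have hd : HasDerivAt (fun z : ℂ => 1 - (2 : ℂ) ^ (1 - z)) (Complex.log 2) 1 := by
    have h := (((hasDerivAt_id (1 : ℂ)).const_sub 1).const_cpow (c := 2)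
      (.inl two_ne_zero)).const_sub 1
    simpa using h
  have hlim := (hasDerivAt_iff_tendsto_slope.mp hd).mul riemannZeta_residue_one
  rw [mul_one] at hlim
  have hlog : ((Real.log 2 : ℝ) : ℂ) = Complex.log 2 := by
    rw [Complex.ofReal_log (by norm_num)]
    norm_num
  rw [hlog]
  refine tendsto_nhds_unique hcont (hlim.congr' ?_)
  have hre : ∀ᶠ z : ℂ in 𝓝[≠] 1, 0 < z.re := nhdsWithin_le_nhds
    ((isOpen_lt continuous_const Complex.continuous_re).mem_nhds (by simp))
  filter_upwards [self_mem_nhdsWithin, hre] with z hz hz0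
  have hz' : z - 1 ≠ 0 := sub_ne_zero.mpr hz
  rw [tsum_pairTerm hz0 hz, slope_def_field]
  simp only [sub_self, Complex.cpow_zero, sub_zero]
  field_simp

theorem ofReal_eta {x : ℝ} (hx : 0 < x) : ((eta x : ℝ) : ℂ) = ∑' k, pairTerm k (x : ℂ) := by
  unfold eta
  split_ifs with h
  · subst h
    rw [Complex.ofReal_one, tsum_pairTerm_one]
  · rw [tsum_pairTerm (by simpa using hx) (by exact_mod_cast h)]
    push_cast
    rw [ofReal_zeta, Complex.ofReal_cpow (by norm_num)]
    push_cast
    rfl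

/-- `η(x) = ∑ (-1)^(n+1) / n^x` for `x > 0`, as a convergent series (the index is shifted by one). -/
theorem tendsto_eta {x : ℝ} (hx : 0 < x) :
    Tendsto (fun N : ℕ => ∑ n ∈ Finset.range N, (-1 : ℝ) ^ n / ((n : ℝ) + 1) ^ x) atTop
      (𝓝 (eta x)) := by
  have hanti : Antitone fun n : ℕ => ((n : ℝ) + 1) ^ (-x) := fun m n hmn =>
    Real.rpow_le_rpow_of_nonpos (by positivity) (by gcongr) (by linarith)
  have hzero : Tendsto (fun n : ℕ => ((n : ℝ) + 1) ^ (-x)) atTop (𝓝 0) :=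
    (tendsto_rpow_neg_atTop hx).comp
      (tendsto_atTop_add_const_right _ 1 tendsto_natCast_atTop_atTop)
  obtain ⟨l, hl⟩ := hanti.tendsto_alternating_series_of_tendsto_zero hzero
  have hsub := hl.comp (tendsto_id.const_mul_atTop' (r := 2) (by norm_num))
  have hpair := (summable_pairTerm (s := (x : ℂ)) (by simpa using hx)).hasSum.tendsto_sum_nat
  rw [← ofReal_eta hx] at hpair
  have hle : l = eta x := by
    have h1 := (Complex.continuous_ofReal.tendsto l).comp hsub
    have h2 : ((l : ℝ) : ℂ) = ((eta x : ℝ) : ℂ) := by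
      refine tendsto_nhds_unique h1 (hpair.congr fun m => ?_)
      rw [sum_pairTerm]
      simp only [Function.comp_apply, id]
      push_cast
      refine Finset.sum_congr rfl fun n _ => ?_
      rw [Complex.ofReal_cpow (by positivity)]
      push_cast
      rfl
    exact_mod_cast h2
  rw [← hle]
  refine hl.congr fun N => Finset.sum_congr rfl fun n _ => ?_
  rw [Real.rpow_neg (by positivity), div_eq_mul_inv]

end HarmonicMeanZeta

namespace HarmonicMeanZeta

open MeasureTheory ProbabilityTheory Filter Topology Set

/-! Since H(a, b) = 2 / (1/a + 1/b), every bound on H(f(x), f(1 - x)) is a bound on F(x) + F(1 - x)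
with F = 1/f. For F strictly convex on [0, 1], that sum is smallest exactly at 1/2 and, for x in (0,
1), strictly below F(0) + F(1). So it suffices that 1/η and -1/ζ are strictly convex, the latter
after continuous extension by 0 at the pole of ζ.

Both follow from η being positive, increasing and strictly concave. Then 1/η is strictly convex and
decreasing, and -1/ζ = (2^(1-x) - 1) · (1/η) is a product of two nonnegative decreasing strictly
convex functions.

Concavity of η is probabilistic. If Y_s = exp(-X) with X gamma of shape s, then E[Y_s^k] =
(k+1)^(-s), so summing a geometric series gives η(s) = E[1/(1 + Y_s)]. Comparing moments, η(s + h) =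
E[1/(1 + Y_s A)] for an independent A distributed as Y_h, and two independent copies A, B give η(s +
2h) = E[1/(1 + Y_s A B)]. A pointwise inequality between the integrands yields strict monotonicity
and strict midpoint concavity (`eta_step`), and continuity does the rest. -/

/-- A continuous function which is strictly midpoint concave on an interval is strictly concave. -/
theorem strictConcaveOn_Icc_of_midpoint {f : ℝ → ℝ} {a b : ℝ} (hf : ContinuousOn f (Icc a b))
    (hmid : ∀ x h, a ≤ x → 0 < h → x + 2 * h ≤ b → f x + f (x + 2 * h) < 2 * f (x + h)) :
    StrictConcaveOn ℝ (Icc a b) f := by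
  refine LinearOrder.strictConcaveOn_of_lt (convex_Icc a b) fun x hx y hy hxy p q hp hq hpq => ?_
  simp only [smul_eq_mul]
  by_contra! hcon
  -- Subtracting the chord of slope m makes the endpoint values equal.
  obtain ⟨m, hm⟩ : ∃ m, f y - f x = m * (y - x) :=
    ⟨(f y - f x) / (y - x), by field_simp [sub_ne_zero.mpr hxy.ne']⟩
  set g : ℝ → ℝ := fun t => f t - m * t with hg
  have hsub : Icc x y ⊆ Icc a b := Icc_subset_Icc hx.1 hy.2
  have hgc : ContinuousOn g (Icc x y) :=
    (hf.mono hsub).sub (continuous_const.mul continuous_id).continuousOn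
  have hgxy : g x = g y := by simp only [hg]; linarith
  set c := p * x + q * y with hc
  have hcx : c - x = q * (y - x) := by rw [hc]; linear_combination x * hpq
  have hcy : y - c = p * (y - x) := by rw [hc]; linear_combination -y * hpq
  have hc1 : x < c := by nlinarith
  have hc2 : c < y := by nlinarith
  have hgc' : g c ≤ g x := by
    have h2 : p * g x + q * g x = g x := by rw [← add_mul, hpq, one_mul]
    have h3 : p * g x + q * g y = p * f x + q * f y - m * c := by simp only [hg, hc]; ring
    have h4 : g c = f c - m * c := rfl
    rw [← hgxy] at h3
    linarith
  obtain ⟨z, hz, hzmin⟩ := isCompact_Icc.exists_isMinOn ⟨x, left_mem_Icc.mpr hxy.le⟩ hgc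
  -- If the minimum is at an endpoint, then c is a minimiser too, because g c ≤ g x = g y. The
  -- midpoint inequality fails at an interior minimiser.
  obtain ⟨w, hw, hwmin⟩ : ∃ w ∈ Ioo x y, ∀ t ∈ Icc x y, g w ≤ g t := by
    rcases eq_or_lt_of_le hz.1 with h | h
    · exact ⟨c, ⟨hc1, hc2⟩, fun t ht => hgc'.trans (h ▸ hzmin ht)⟩
    rcases eq_or_lt_of_le hz.2 with h' | h'
    · exact ⟨c, ⟨hc1, hc2⟩, fun t ht => (hgc'.trans hgxy.le).trans (h' ▸ hzmin ht)⟩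
    exact ⟨z, ⟨h, h'⟩, fun t ht => hzmin ht⟩
  set d := min (w - x) (y - w) with hd
  have hd0 : 0 < d := lt_min (sub_pos.mpr hw.1) (sub_pos.mpr hw.2)
  have hdx : d ≤ w - x := min_le_left _ _
  have hdy : d ≤ y - w := min_le_right _ _
  have h1 := hmid (w - d) d (by linarith [hx.1]) hd0 (by linarith [hy.2])
  rw [show w - d + 2 * d = w + d by ring, show w - d + d = w by ring] at h1
  have h2 := hwmin (w - d) ⟨by linarith, by linarith⟩
  have h3 := hwmin (w + d) ⟨by linarith, by linarith⟩
  simp only [hg] at h2 h3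
  linarith

/-! ### Integral representation of η by gamma variables -/

/-- A measure on `(0, 1]` whose moments are `(k + 1) ^ (-s)`, namely the law of `exp (-X)` for a
gamma variable `X` of shape `s`. -/
theorem exists_measure_moments {s : ℝ} (hs : 0 ≤ s) : ∃ μ : Measure ℝ, IsProbabilityMeasure μ ∧
    (∀ᵐ y ∂μ, 0 < y ∧ y ≤ 1) ∧ (0 < s → ∀ᵐ y ∂μ, y < 1) ∧
    ∀ k : ℕ, ∫ y, y ^ k ∂μ = ((k : ℝ) + 1) ^ (-s) := by
  rcases hs.eq_or_lt with rfl | hs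
  -- Shape 0 is the degenerate variable X = 0, so exp (-X) = 1; hence y < 1 is claimed only for s >
  -- 0.
  · refine ⟨Measure.dirac 1, inferInstance, ?_, fun h => absurd h (lt_irrefl _), fun k => by simp⟩
    rw [ae_dirac_eq]
    simp
  have hprob := isProbabilityMeasure_gammaMeasure hs one_pos
  have hpos : ∀ᵐ x ∂gammaMeasure s 1, 0 < x := by
    rw [gammaMeasure, ae_withDensity_iff (by unfold gammaPDF; fun_prop)]
    -- The density need not vanish at 0 (for instance when s = 1), so this null point is removed
    -- separately.
    have h0 : ∀ᵐ x : ℝ, x ≠ 0 := by simp [ae_iff]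
    filter_upwards [h0] with x hx h
    by_contra! hx0
    exact h (gammaPDF_of_neg (lt_of_le_of_ne hx0 hx))
  have hm : Measurable fun x : ℝ => Real.exp (-x) := by fun_prop
  refine ⟨(gammaMeasure s 1).map fun x => Real.exp (-x),
    Measure.isProbabilityMeasure_map hm.aemeasurable, ?_, fun _ => ?_, fun k => ?_⟩
  · refine (ae_map_iff hm.aemeasurable measurableSet_Ioc).mpr ?_
    filter_upwards [hpos] with x hx
    exact ⟨Real.exp_pos _, Real.exp_le_one_iff.mpr (by linarith)⟩
  · refine (ae_map_iff hm.aemeasurable measurableSet_Iio).mpr ?_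
    filter_upwards [hpos] with x hx
    rw [← Real.exp_zero]
    exact Real.exp_lt_exp.mpr (by linarith)
  · rw [integral_map hm.aemeasurable (by fun_prop), gammaMeasure,
      integral_withDensity_eq_integral_toReal_smul (by unfold gammaPDF; fun_prop)
        (ae_of_all _ fun x => by simp [gammaPDF])]
    have hk : (0 : ℝ) < k + 1 := by positivity
    have h1 : ∀ x : ℝ, (gammaPDF s 1 x).toReal • Real.exp (-x) ^ k =
        (Ici (0 : ℝ)).indicator
          (fun x => (Real.Gamma s)⁻¹ * (x ^ (s - 1) * Real.exp (-((k + 1) * x)))) x := by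
      intro x
      rw [gammaPDF, ENNReal.toReal_ofReal (gammaPDFReal_nonneg hs one_pos x), gammaPDFReal,
        indicator_apply]
      by_cases hx : 0 ≤ x
      · rw [if_pos hx, if_pos (mem_Ici.mpr hx), Real.one_rpow, ← Real.exp_nat_mul, smul_eq_mul,
          mul_assoc, mul_assoc, one_div, ← Real.exp_add]
        congr 4
        ring
      · rw [if_neg hx, if_neg (by simpa using hx), zero_smul]
    simp_rw [h1]
    rw [integral_indicator measurableSet_Ici, integral_Ici_eq_integral_Ioi, integral_const_mul,
      Real.integral_rpow_mul_exp_neg_mul_Ioi hs hk, mul_left_comm,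
      inv_mul_cancel₀ (Real.Gamma_pos_of_pos hs).ne', mul_one, one_div,
      Real.inv_rpow hk.le, Real.rpow_neg hk.le]

theorem eta_zero : eta 0 = 1 / 2 := by
  have h : zeta 0 = -1 / 2 := by simp [zeta, riemannZeta_zero]
  rw [eta, if_neg zero_ne_one, h]
  norm_num

section

variable {Ω : Type*} [MeasurableSpace Ω] {μ : Measure Ω} [IsProbabilityMeasure μ] {Z : Ω → ℝ}

theorem integrable_pow_of_mem_unit (hZ : Measurable Z) (h01 : ∀ᵐ ω ∂μ, 0 < Z ω ∧ Z ω ≤ 1)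
    (k : ℕ) : Integrable (fun ω => Z ω ^ k) μ := by
  refine Integrable.of_bound (hZ.pow_const k).aestronglyMeasurable 1 ?_
  filter_upwards [h01] with ω h
  rw [Real.norm_eq_abs, abs_of_nonneg (pow_nonneg h.1.le k)]
  exact pow_le_one₀ h.1.le h.2

theorem integrable_inv_one_add (hZ : Measurable Z) (h01 : ∀ᵐ ω ∂μ, 0 < Z ω ∧ Z ω ≤ 1) :
    Integrable (fun ω => (1 + Z ω)⁻¹) μ := by
  refine Integrable.of_bound (by fun_prop) 1 ?_
  filter_upwards [h01] with ω h
  rw [Real.norm_eq_abs, abs_of_nonneg (by have := h.1; positivity)]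
  exact inv_le_one_of_one_le₀ (by linarith [h.1])

/-- For s > 0, the N-th partial sum of the alternating series is the integral of a geometric sum,
which differs from 1/(1 + Z) by at most Z^N; the integral of Z^N is (N+1)^(-s) → 0. For s = 0 the
series is unavailable, but Z ≤ 1 with mean 1 forces Z = 1 almost everywhere. Only the moments of Z
enter, so products of independent variables can be used. -/
theorem integral_inv_one_add {s : ℝ} (hs : 0 ≤ s) (hZ : Measurable Z)
    (h01 : ∀ᵐ ω ∂μ, 0 < Z ω ∧ Z ω ≤ 1) (hmom : ∀ k : ℕ, ∫ ω, Z ω ^ k ∂μ = ((k : ℝ) + 1) ^ (-s)) :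
    ∫ ω, (1 + Z ω)⁻¹ ∂μ = eta s := by
  rcases hs.eq_or_lt with rfl | hs
  · have h1 : ∫ ω, (1 - Z ω) ∂μ = 0 := by
      have hi : Integrable Z μ := by simpa using integrable_pow_of_mem_unit hZ h01 1
      have := hmom 1
      simp only [pow_one, neg_zero, Real.rpow_zero] at this
      rw [integral_sub (integrable_const 1) hi, this]
      simp
    have h2 : (fun ω => 1 - Z ω) =ᵐ[μ] 0 := by
      rwa [integral_eq_zero_iff_of_nonneg_ae] at h1
      · filter_upwards [h01] with ω h using sub_nonneg.mpr h.2
      · exact (integrable_const 1).sub (by simpa using integrable_pow_of_mem_unit hZ h01 1)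
    have h3 : ∫ ω, (1 + Z ω)⁻¹ ∂μ = ∫ _, (2 : ℝ)⁻¹ ∂μ := by
      refine integral_congr_ae ?_
      filter_upwards [h2] with ω h
      have : Z ω = 1 := by simp only [Pi.zero_apply] at h; linarith
      rw [this]
      norm_num
    rw [h3, eta_zero]
    simp
  · refine tendsto_nhds_unique ?_ (tendsto_eta hs)
    have hlim : Tendsto (fun n : ℕ => ((n : ℝ) + 1) ^ (-s)) atTop (𝓝 0) :=
      (tendsto_rpow_neg_atTop hs).comp
        (tendsto_atTop_add_const_right _ 1 tendsto_natCast_atTop_atTop)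
    rw [tendsto_iff_norm_sub_tendsto_zero]
    refine squeeze_zero (fun _ => norm_nonneg _) (fun N => ?_) hlim
    have hsum : ∑ n ∈ Finset.range N, (-1 : ℝ) ^ n / ((n : ℝ) + 1) ^ s
        = ∫ ω, ∑ n ∈ Finset.range N, (-1 : ℝ) ^ n * Z ω ^ n ∂μ := by
      rw [integral_finsetSum _ fun n _ => (integrable_pow_of_mem_unit hZ h01 n).const_mul _]
      refine Finset.sum_congr rfl fun n _ => ?_
      rw [integral_const_mul, hmom, Real.rpow_neg (by positivity), div_eq_mul_inv]
    rw [hsum, ← integral_sub (integrable_finsetSum _ fun n _ =>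
      (integrable_pow_of_mem_unit hZ h01 n).const_mul _) (integrable_inv_one_add hZ h01), ← hmom N]
    refine norm_integral_le_of_norm_le (integrable_pow_of_mem_unit hZ h01 N) ?_
    filter_upwards [h01] with ω h
    have hz : 0 < 1 + Z ω := by linarith [h.1]
    have hgeo : ∑ n ∈ Finset.range N, (-1 : ℝ) ^ n * Z ω ^ n
        = (1 - (-Z ω) ^ N) / (1 + Z ω) := by
      rw [eq_div_iff hz.ne']
      have := geom_sum_mul_neg (-Z ω) N
      rw [sub_neg_eq_add] at this
      rw [← this]
      congr 1
      exact Finset.sum_congr rfl fun n _ => by rw [← mul_pow, neg_one_mul]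
    have hdiff : (1 - (-Z ω) ^ N) / (1 + Z ω) - (1 + Z ω)⁻¹ = -((-Z ω) ^ N / (1 + Z ω)) := by
      field_simp
      ring
    rw [hgeo, hdiff, norm_neg, norm_div, norm_pow, norm_neg, Real.norm_of_nonneg h.1.le,
      Real.norm_of_nonneg hz.le]
    exact div_le_self (pow_nonneg h.1.le N) (by linarith [h.1])

end

/-! ### Monotonicity and strict concavity of η -/

theorem eta_step {s h : ℝ} (hs : 0 ≤ s) (hh : 0 < h) :
    eta s < eta (s + h) ∧ eta s + eta (s + 2 * h) < 2 * eta (s + h) := by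
  obtain ⟨μ, hμ, hμ01, -, hμk⟩ := exists_measure_moments hs
  obtain ⟨ν, hν, hν01, hν1, hνk⟩ := exists_measure_moments hh.le
  have hν1 := hν1 hh
  set P : Measure (ℝ × ℝ × ℝ) := μ.prod (ν.prod ν) with hP
  have hy : ∀ᵐ p ∂P, 0 < p.1 ∧ p.1 ≤ 1 := Measure.quasiMeasurePreserving_fst.ae hμ01
  have ha : ∀ᵐ p ∂P, (0 < p.2.1 ∧ p.2.1 ≤ 1) ∧ p.2.1 < 1 :=
    Measure.quasiMeasurePreserving_snd.ae (Measure.quasiMeasurePreserving_fst.ae (hν01.and hν1))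
  have hb : ∀ᵐ p ∂P, (0 < p.2.2 ∧ p.2.2 ≤ 1) ∧ p.2.2 < 1 :=
    Measure.quasiMeasurePreserving_snd.ae (Measure.quasiMeasurePreserving_snd.ae (hν01.and hν1))
  -- Independence factors the mixed moments, so multiplying by a factor of law ν raises the exponent
  -- s by h.
  have hmom : ∀ i j k : ℕ, ∫ p, p.1 ^ i * (p.2.1 ^ j * p.2.2 ^ k) ∂P =
      ((i : ℝ) + 1) ^ (-s) * (((j : ℝ) + 1) ^ (-h) * ((k : ℝ) + 1) ^ (-h)) := by
    intro i j k
    rw [hP, integral_prod_mul (fun y : ℝ => y ^ i) (fun q : ℝ × ℝ => q.1 ^ j * q.2 ^ k),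
      integral_prod_mul (fun y : ℝ => y ^ j) (fun y : ℝ => y ^ k), hμk, hνk, hνk]
  have h0 : ∀ᵐ p ∂P, 0 < p.1 ∧ p.1 ≤ 1 := hy
  have h1 : ∀ᵐ p ∂P, 0 < p.1 * p.2.1 ∧ p.1 * p.2.1 ≤ 1 := by
    filter_upwards [hy, ha] with p hy ha
    exact ⟨mul_pos hy.1 ha.1.1, mul_le_one₀ hy.2 ha.1.1.le ha.1.2⟩
  have h1' : ∀ᵐ p ∂P, 0 < p.1 * p.2.2 ∧ p.1 * p.2.2 ≤ 1 := by
    filter_upwards [hy, hb] with p hy hb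
    exact ⟨mul_pos hy.1 hb.1.1, mul_le_one₀ hy.2 hb.1.1.le hb.1.2⟩
  have h2 : ∀ᵐ p ∂P, 0 < p.1 * p.2.1 * p.2.2 ∧ p.1 * p.2.1 * p.2.2 ≤ 1 := by
    filter_upwards [h1, hb] with p hy hb
    exact ⟨mul_pos hy.1 hb.1.1, mul_le_one₀ hy.2 hb.1.1.le hb.1.2⟩
  have m0 : Measurable fun p : ℝ × ℝ × ℝ => p.1 := by fun_prop
  have m1 : Measurable fun p : ℝ × ℝ × ℝ => p.1 * p.2.1 := by fun_prop
  have m1' : Measurable fun p : ℝ × ℝ × ℝ => p.1 * p.2.2 := by fun_prop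
  have m2 : Measurable fun p : ℝ × ℝ × ℝ => p.1 * p.2.1 * p.2.2 := by fun_prop
  have e0 : ∫ p, (1 + p.1)⁻¹ ∂P = eta s := integral_inv_one_add hs m0 h0 fun k => by
    simpa using hmom k 0 0
  have e1 : ∫ p, (1 + p.1 * p.2.1)⁻¹ ∂P = eta (s + h) :=
    integral_inv_one_add (by positivity) m1 h1 fun k => by
      simpa [mul_pow, neg_add, ← Real.rpow_add (by positivity : (0 : ℝ) < k + 1), add_comm]
        using hmom k k 0
  have e1' : ∫ p, (1 + p.1 * p.2.2)⁻¹ ∂P = eta (s + h) :=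
    integral_inv_one_add (by positivity) m1' h1' fun k => by
      simpa [mul_pow, neg_add, ← Real.rpow_add (by positivity : (0 : ℝ) < k + 1), add_comm]
        using hmom k 0 k
  have e2 : ∫ p, (1 + p.1 * p.2.1 * p.2.2)⁻¹ ∂P = eta (s + 2 * h) :=
    integral_inv_one_add (by positivity) m2 h2 fun k => by
      have := hmom k k k
      rw [← Real.rpow_add (by positivity), ← Real.rpow_add (by positivity)] at this
      rw [show -(s + 2 * h) = -s + (-h + -h) by ring, ← this]
      exact integral_congr_ae (ae_of_all _ fun p => by ring)
  have i0 := integrable_inv_one_add m0 h0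
  have i1 := integrable_inv_one_add m1 h1
  have i1' := integrable_inv_one_add m1' h1'
  have i2 := integrable_inv_one_add m2 h2
  have i11 : Integrable (fun p => (1 + p.1 * p.2.1)⁻¹ + (1 + p.1 * p.2.2)⁻¹) P := i1.add i1'
  have i02 : Integrable (fun p => (1 + p.1)⁻¹ + (1 + p.1 * p.2.1 * p.2.2)⁻¹) P := i0.add i2
  have hpos : ∀ f : ℝ × ℝ × ℝ → ℝ, Integrable f P → (∀ᵐ p ∂P, 0 < f p) → 0 < ∫ p, f p ∂P := by
    intro f hf h
    rw [integral_pos_iff_support_of_nonneg_ae (h.mono fun p hp => hp.le) hf]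
    have : Function.support f =ᵐ[P] univ := by
      rw [eventuallyEq_univ]
      exact h.mono fun p hp => hp.ne'
    rw [measure_congr this, measure_univ]
    exact one_pos
  constructor
  · have := hpos (fun p => (1 + p.1 * p.2.1)⁻¹ - (1 + p.1)⁻¹) (i1.sub i0) (by
      filter_upwards [hy, h1, ha] with p hy h1 ha
      refine sub_pos.mpr (inv_strictAnti₀ (by linarith) ?_)
      nlinarith)
    rw [integral_sub i1 i0, e0, e1] at this
    linarith
  · have := hpos (fun p => ((1 + p.1 * p.2.1)⁻¹ + (1 + p.1 * p.2.2)⁻¹)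
        - ((1 + p.1)⁻¹ + (1 + p.1 * p.2.1 * p.2.2)⁻¹)) (i11.sub i02) (by
      filter_upwards [hy, ha, hb, h1, h1', h2] with ⟨y, a, b⟩ hy ha hb h1 h1' h2
      dsimp only at *
      -- The second difference of integrands has numerator y(1 - a)(1 - b)(1 - aby²); this makes the
      -- last factor positive.
      have hlt : a * (b * y ^ 2) < 1 := by
        have : b * y ^ 2 ≤ 1 := mul_le_one₀ hb.1.2 (by positivity) (pow_le_one₀ hy.1.le hy.2)
        exact mul_lt_one_of_nonneg_of_lt_one_left ha.1.1.le ha.2 this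
      have d0 : 0 < 1 + y := by linarith
      have d1 : 0 < 1 + y * a := by linarith
      have d2 : 0 < 1 + y * b := by linarith
      have d3 : 0 < 1 + y * a * b := by linarith
      have : (1 + y * a)⁻¹ + (1 + y * b)⁻¹ - ((1 + y)⁻¹ + (1 + y * a * b)⁻¹)
          = y * (1 - a) * (1 - b) * (1 - a * (b * y ^ 2)) /
            ((1 + y) * (1 + y * a) * (1 + y * b) * (1 + y * a * b)) := by
        field_simp
        ring
      rw [this]
      have := sub_pos.mpr ha.2
      have := sub_pos.mpr hb.2
      have := sub_pos.mpr hlt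
      have := hy.1
      positivity)
    rw [integral_sub i11 i02, integral_add i1 i1', integral_add i0 i2, e0, e1,
      e1', e2] at this
    linarith

theorem eta_strictMonoOn : StrictMonoOn eta (Ici 0) := fun x hx y _ hxy => by
  simpa using (eta_step (h := y - x) hx (sub_pos.mpr hxy)).1

theorem eta_pos {x : ℝ} (hx : 0 ≤ x) : 0 < eta x := by
  have := eta_strictMonoOn.monotoneOn (mem_Ici.mpr le_rfl) (mem_Ici.mpr hx) hx
  rw [eta_zero] at this
  linarith

/-- The grouped series is continuous on x > 0, across the removable singularity at 1; at 0, outside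
its range here, the product formula is used. -/
theorem continuousAt_eta {x : ℝ} (hx : 0 ≤ x) : ContinuousAt eta x := by
  rcases hx.eq_or_lt with rfl | hx
  · have hz : ContinuousAt zeta 0 := by
      refine Complex.continuous_re.continuousAt.comp (ContinuousAt.comp (g := riemannZeta) ?_
        Complex.continuous_ofReal.continuousAt)
      exact (differentiableAt_riemannZeta (by simp)).continuousAt
    have hc : ContinuousAt (fun x : ℝ => (1 - (2 : ℝ) ^ (1 - x)) * zeta x) 0 := by
      refine ContinuousAt.mul ?_ hz
      have : Continuous fun x : ℝ => (2 : ℝ) ^ (1 - x) :=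
        
        Real.continuous_const_rpow two_ne_zero |>.comp (continuous_const.sub continuous_id)
      exact (continuous_const.sub this).continuousAt
    refine hc.congr ?_
    filter_upwards [isOpen_ne.mem_nhds (zero_ne_one (α := ℝ))] with y hy
    rw [eta, if_neg hy]
  · have hc : ContinuousAt (fun y : ℝ => (∑' k, pairTerm k (y : ℂ)).re) x := by
      refine Complex.continuous_re.continuousAt.comp (ContinuousAt.comp
        (g := fun z : ℂ => ∑' k, pairTerm k z) ?_ Complex.continuous_ofReal.continuousAt)
      exact (differentiableAt_tsum_pairTerm (by simpa using hx)).continuousAt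
    refine hc.congr ?_
    filter_upwards [isOpen_Ioi.mem_nhds hx] with y hy
    rw [← ofReal_eta hy, Complex.ofReal_re]

theorem strictConcaveOn_eta : StrictConcaveOn ℝ (Icc 0 1) eta :=
  strictConcaveOn_Icc_of_midpoint
    (fun _ hx => (continuousAt_eta hx.1).continuousWithinAt)
    fun _ _ hx hh _ => (eta_step hx hh).2

/-! ### Convexity of reciprocals and products, and reflection bounds -/

theorem strictConvexOn_inv_of_strictConcaveOn {f : ℝ → ℝ} {S : Set ℝ}
    (hf : StrictConcaveOn ℝ S f) (h0 : ∀ x ∈ S, 0 < f x) :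
    StrictConvexOn ℝ S fun x => (f x)⁻¹ := by
  refine ⟨hf.1, fun x hx y hy hxy a b ha hb hab => ?_⟩
  have h1 := hf.2 hx hy hxy ha hb hab
  have h2 := (convexOn_zpow (𝕜 := ℝ) (-1)).2 (h0 x hx) (h0 y hy) ha.le hb.le hab
  simp only [zpow_neg_one, smul_eq_mul] at h1 h2 ⊢
  have hx0 := h0 x hx
  have hy0 := h0 y hy
  exact (inv_strictAnti₀ (by positivity) h1).trans_le h2

/-- The product of the averages is at most the average of the products, as in Chebyshev's
inequality: the gap is ab(f x - f y)(g x - g y), nonnegative because both functions decrease. -/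
theorem strictConvexOn_mul_of_antitoneOn {f g : ℝ → ℝ} {S : Set ℝ} (hf : StrictConvexOn ℝ S f)
    (hg : StrictConvexOn ℝ S g) (hf0 : ∀ x ∈ S, 0 ≤ f x) (hg0 : ∀ x ∈ S, 0 ≤ g x)
    (hfa : AntitoneOn f S) (hga : AntitoneOn g S) : StrictConvexOn ℝ S fun x => f x * g x := by
  refine ⟨hf.1, fun x hx y hy hxy a b ha hb hab => ?_⟩
  have h1 := hf.2 hx hy hxy ha hb hab
  have h2 := hg.2 hx hy hxy ha hb hab
  have hz := hf.1 hx hy ha.le hb.le hab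
  simp only [smul_eq_mul] at h1 h2 hz ⊢
  have h3 := mul_lt_mul'' h1 h2 (hf0 _ hz) (hg0 _ hz)
  have h4 : 0 ≤ (f x - f y) * (g x - g y) := by
    rcases le_total x y with h | h
    · exact mul_nonneg (sub_nonneg.mpr (hfa hx hy h)) (sub_nonneg.mpr (hga hx hy h))
    · exact mul_nonneg_of_nonpos_of_nonpos (sub_nonpos.mpr (hfa hy hx h))
        (sub_nonpos.mpr (hga hy hx h))
  have h5 : a * (f x * g x) + b * (f y * g y) - (a * f x + b * f y) * (a * g x + b * g y)
      = a * b * ((f x - f y) * (g x - g y)) := by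
    obtain rfl : b = 1 - a := by linarith
    ring
  have h6 := mul_nonneg (mul_pos ha hb).le h4
  linarith

/-- The lower bound is convexity at the midpoint of x and 1 - x; the upper one adds the chord bounds
at x and 1 - x, whose weights on 0 and 1 are swapped. -/
theorem add_reflect_bounds {F : ℝ → ℝ} (hF : StrictConvexOn ℝ (Icc 0 1) F) {x : ℝ}
    (hx : x ∈ Icc (0 : ℝ) 1) :
    (x ≠ 1 / 2 → 2 * F (1 / 2) < F x + F (1 - x)) ∧
    (x ∈ Ioo (0 : ℝ) 1 → F x + F (1 - x) < F 0 + F 1) := by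
  have hx' : 1 - x ∈ Icc (0 : ℝ) 1 := ⟨by linarith [hx.2], by linarith [hx.1]⟩
  constructor
  · intro hne
    have h := hF.2 hx hx' (fun h => hne (by linarith)) (by norm_num : (0 : ℝ) < 1 / 2)
      (by norm_num : (0 : ℝ) < 1 / 2) (by norm_num)
    simp only [smul_eq_mul] at h
    rw [show 1 / 2 * x + 1 / 2 * (1 - x) = 1 / 2 by ring] at h
    linarith
  · intro hxo
    have m0 : (0 : ℝ) ∈ Icc (0 : ℝ) 1 := ⟨le_rfl, zero_le_one⟩
    have m1 : (1 : ℝ) ∈ Icc (0 : ℝ) 1 := ⟨zero_le_one, le_rfl⟩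
    have p := sub_pos.mpr hxo.2
    have h := hF.2 m0 m1 zero_ne_one p hxo.1 (by ring)
    have h' := hF.2 m0 m1 zero_ne_one hxo.1 p (by ring)
    simp only [smul_eq_mul, mul_zero, mul_one, zero_add] at h h'
    linarith

theorem H_eq {a b : ℝ} (ha : a ≠ 0) (hb : b ≠ 0) : H a b = 2 / (a⁻¹ + b⁻¹) := by
  have h : a⁻¹ + b⁻¹ = (a + b) / (a * b) := by
    field_simp
    ring
  rw [H, h, div_div_eq_mul_div, mul_assoc]

/-! ### The reciprocal of ζ and its harmonic mean -/

/-- The continuous extension of `-1 / ζ` from `[0, 1)` to `[0, ∞)`. -/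
noncomputable def negInvZeta (x : ℝ) : ℝ := ((2 : ℝ) ^ (1 - x) - 1) * (eta x)⁻¹

theorem negInvZeta_zero : negInvZeta 0 = 2 := by
  rw [negInvZeta, eta_zero]
  norm_num

theorem negInvZeta_one : negInvZeta 1 = 0 := by
  simp [negInvZeta]

theorem negInvZeta_pos {x : ℝ} (hx : x ∈ Ico (0 : ℝ) 1) : 0 < negInvZeta x :=
  mul_pos (sub_pos.mpr (Real.one_lt_rpow one_lt_two (sub_pos.mpr hx.2)))
    (inv_pos.mpr (eta_pos hx.1))

theorem inv_zeta {x : ℝ} (hx : x ∈ Ico (0 : ℝ) 1) : (zeta x)⁻¹ = -negInvZeta x := by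
  have h := Real.one_lt_rpow one_lt_two (sub_pos.mpr hx.2)
  have h' : 1 - (2 : ℝ) ^ (1 - x) ≠ 0 := by linarith
  rw [negInvZeta, eta, if_neg hx.2.ne, mul_inv, ← mul_assoc, ← neg_mul, ← neg_mul, neg_sub,
    mul_inv_cancel₀ h', one_mul]

theorem zeta_neg {x : ℝ} (hx : x ∈ Ico (0 : ℝ) 1) : zeta x < 0 := by
  rw [← inv_lt_zero, inv_zeta hx]
  exact neg_lt_zero.mpr (negInvZeta_pos hx)

theorem continuousOn_negInvZeta : ContinuousOn negInvZeta (Icc 0 1) := by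
  intro x hx
  have h : Continuous fun x : ℝ => (2 : ℝ) ^ (1 - x) :=
    (Real.continuous_const_rpow two_ne_zero).comp (continuous_const.sub continuous_id)
  exact ((h.sub continuous_const).continuousAt.mul
    ((continuousAt_eta hx.1).inv₀ (eta_pos hx.1).ne')).continuousWithinAt

theorem strictConvexOn_inv_eta : StrictConvexOn ℝ (Icc 0 1) fun x => (eta x)⁻¹ :=
  strictConvexOn_inv_of_strictConcaveOn strictConcaveOn_eta fun _ hx => eta_pos hx.1

theorem strictConvexOn_two_rpow_one_sub :
    StrictConvexOn ℝ (Icc 0 1) fun x : ℝ => (2 : ℝ) ^ (1 - x) - 1 := by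
  refine ⟨convex_Icc 0 1, fun x _ y _ hxy a b ha hb hab => ?_⟩
  have hlog := Real.log_pos one_lt_two
  have h := strictConvexOn_exp.2 (mem_univ (Real.log 2 * (1 - x)))
    (mem_univ (Real.log 2 * (1 - y)))
    (fun h => hxy (by linarith [mul_left_cancel₀ hlog.ne' h])) ha hb hab
  simp only [smul_eq_mul, Real.rpow_def_of_pos two_pos] at h ⊢
  rw [show Real.log 2 * (1 - (a * x + b * y))
    = a * (Real.log 2 * (1 - x)) + b * (Real.log 2 * (1 - y)) by
      linear_combination -Real.log 2 * hab]
  linarith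

theorem strictConvexOn_negInvZeta : StrictConvexOn ℝ (Icc 0 1) negInvZeta := by
  refine strictConvexOn_mul_of_antitoneOn strictConvexOn_two_rpow_one_sub strictConvexOn_inv_eta
    (fun x hx => ?_) (fun x hx => (inv_pos.mpr (eta_pos hx.1)).le) ?_ ?_
  · exact sub_nonneg.mpr (Real.one_le_rpow one_le_two (sub_nonneg.mpr hx.2))
  · intro x _ y _ hxy
    exact sub_le_sub_right (Real.rpow_le_rpow_of_exponent_le one_le_two (by linarith)) 1
  · intro x hx y hy hxy
    exact inv_anti₀ (eta_pos hx.1) (eta_strictMonoOn.monotoneOn hx.1 hy.1 hxy)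

theorem one_sub_mem_Ioo {x : ℝ} (hx : x ∈ Ioo (0 : ℝ) 1) : 1 - x ∈ Ioo (0 : ℝ) 1 :=
  ⟨by linarith [hx.2], by linarith [hx.1]⟩

theorem H_zeta {x : ℝ} (hx : x ∈ Ioo (0 : ℝ) 1) :
    H (zeta x) (zeta (1 - x)) = -2 / (negInvZeta x + negInvZeta (1 - x)) := by
  have h1 := Ioo_subset_Ico_self hx
  have h2 := Ioo_subset_Ico_self (one_sub_mem_Ioo hx)
  rw [H_eq (zeta_neg h1).ne (zeta_neg h2).ne, inv_zeta h1, inv_zeta h2, ← neg_add, div_neg,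
    neg_div]

theorem zeta_half : zeta (1 / 2) = -2 / (2 * negInvZeta (1 / 2)) := by
  rw [← inv_inv (zeta (1 / 2)), inv_zeta (by norm_num [mem_Ico]), inv_neg]
  field_simp

/-- The formula -2 / (F(x) + F(1 - x)), with F = `negInvZeta`, is continuous up to the endpoints;
the pole of ζ has become the zero F(1) = 0. -/
theorem tendsto_H_zeta {c : ℝ} (hc : c ∈ Icc (0 : ℝ) 1)
    (hval : negInvZeta c + negInvZeta (1 - c) = 2) :
    Tendsto (fun x : ℝ => H (zeta x) (zeta (1 - x))) (𝓝[Ioo 0 1] c) (𝓝 (-1)) := by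
  have hcont : ContinuousOn (fun x => negInvZeta x + negInvZeta (1 - x)) (Icc 0 1) :=
    continuousOn_negInvZeta.add (continuousOn_negInvZeta.comp
      (continuous_const.sub continuous_id).continuousOn
      fun x hx => ⟨by simpa using hx.2, by simpa using hx.1⟩)
  have h := (hcont c hc).mono_left (nhdsWithin_mono c Ioo_subset_Icc_self)
  simp only [hval] at h
  have h2 := (tendsto_const_nhds (x := (-2 : ℝ))).div h two_ne_zero
  rw [show (-2 : ℝ) / 2 = -1 by norm_num] at h2
  refine h2.congr' ?_
  filter_upwards [self_mem_nhdsWithin] with x hx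
  exact (H_zeta hx).symm

/-! ### The harmonic mean of η -/

theorem H_eta {x : ℝ} (hx : x ∈ Icc (0 : ℝ) 1) :
    H (eta x) (eta (1 - x)) = 2 / ((eta x)⁻¹ + (eta (1 - x))⁻¹) :=
  H_eq (eta_pos hx.1).ne' (eta_pos (by linarith [hx.2])).ne'

theorem eta_half : (1 - √2) * zeta (1 / 2) = eta (1 / 2) := by
  rw [eta, if_neg (by norm_num), Real.sqrt_eq_rpow]
  norm_num

theorem eta_one : eta 1 = Real.log 2 := by simp [eta]

/-- The lower constant is the harmonic mean of η(0) = 1/2 and η(1) = log 2. -/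
theorem log_four_div : Real.log 4 / (1 + Real.log 4) = 2 / ((eta 0)⁻¹ + (eta 1)⁻¹) := by
  have hlog := Real.log_pos one_lt_two
  rw [show (4 : ℝ) = 2 ^ 2 by norm_num, Real.log_pow, eta_zero, eta_one]
  push_cast
  field_simp
  ring

end HarmonicMeanZeta

open Set HarmonicMeanZeta in
theorem mainTheorem3 :
    -- `1/ζ` is strictly concave on `(0, 1)`
    StrictConcaveOn ℝ (Set.Ioo 0 1) (fun x : ℝ => 1 / HarmonicMeanZeta.zeta x) ∧
    -- the bounds for `ζ`; the lower one is attained exactly at `1/2`,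
    -- the upper one is the limiting value at the end points `0` and `1`
    (∀ x ∈ Set.Ioo (0 : ℝ) 1,
      HarmonicMeanZeta.zeta (1 / 2) ≤
        HarmonicMeanZeta.H (HarmonicMeanZeta.zeta x) (HarmonicMeanZeta.zeta (1 - x)) ∧
      HarmonicMeanZeta.H (HarmonicMeanZeta.zeta x) (HarmonicMeanZeta.zeta (1 - x)) < -1 ∧
      (HarmonicMeanZeta.H (HarmonicMeanZeta.zeta x) (HarmonicMeanZeta.zeta (1 - x)) =
        HarmonicMeanZeta.zeta (1 / 2) ↔ x = 1 / 2)) ∧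
    Filter.Tendsto
      (fun x : ℝ =>
        HarmonicMeanZeta.H (HarmonicMeanZeta.zeta x) (HarmonicMeanZeta.zeta (1 - x)))
      (nhdsWithin 0 (Set.Ioo 0 1)) (nhds (-1)) ∧
    Filter.Tendsto
      (fun x : ℝ =>
        HarmonicMeanZeta.H (HarmonicMeanZeta.zeta x) (HarmonicMeanZeta.zeta (1 - x)))
      (nhdsWithin 1 (Set.Ioo 0 1)) (nhds (-1)) ∧
    -- the bounds for `η`, including the end points
    (∀ x ∈ Set.Icc (0 : ℝ) 1,
      Real.log 4 / (1 + Real.log 4) ≤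
        HarmonicMeanZeta.H (HarmonicMeanZeta.eta x) (HarmonicMeanZeta.eta (1 - x)) ∧
      HarmonicMeanZeta.H (HarmonicMeanZeta.eta x) (HarmonicMeanZeta.eta (1 - x)) ≤
        (1 - √2) * HarmonicMeanZeta.zeta (1 / 2) ∧
      (HarmonicMeanZeta.H (HarmonicMeanZeta.eta x) (HarmonicMeanZeta.eta (1 - x)) =
        Real.log 4 / (1 + Real.log 4) ↔ x = 0 ∨ x = 1) ∧
      (HarmonicMeanZeta.H (HarmonicMeanZeta.eta x) (HarmonicMeanZeta.eta (1 - x)) =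
        (1 - √2) * HarmonicMeanZeta.zeta (1 / 2) ↔ x = 1 / 2)) := by

  have half_mem : (1 / 2 : ℝ) ∈ Icc (0 : ℝ) 1 := by norm_num [mem_Icc]
  refine ⟨?_, fun x hx => ?_, tendsto_H_zeta (by simp) (by simp [negInvZeta_zero, negInvZeta_one]),
    tendsto_H_zeta (by simp) (by simp [negInvZeta_zero, negInvZeta_one]), fun x hx => ?_⟩
  · have h := (strictConvexOn_negInvZeta.subset Ioo_subset_Icc_self (convex_Ioo 0 1)).neg
    refine h.congr fun x hx => ?_
    rw [one_div, inv_zeta (Ioo_subset_Ico_self hx)]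
    rfl
  · have hpos : 0 < negInvZeta (1 / 2) := negInvZeta_pos (by norm_num [mem_Ico])
    have hb := add_reflect_bounds strictConvexOn_negInvZeta (Ioo_subset_Icc_self hx)
    have hup := hb.2 hx
    have hp1 := negInvZeta_pos (Ioo_subset_Ico_self hx)
    have hp2 := negInvZeta_pos (Ioo_subset_Ico_self (one_sub_mem_Ioo hx))
    -- The endpoint sum F(0) + F(1) = 2 + 0 is the source of the bound -1.
    rw [negInvZeta_zero, negInvZeta_one, add_zero] at hup
    have hstrict : x ≠ 1 / 2 → zeta (1 / 2) < H (zeta x) (zeta (1 - x)) := fun hne => by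
      rw [H_zeta hx, zeta_half, neg_div, neg_div, neg_lt_neg_iff]
      exact div_lt_div_of_pos_left two_pos (by positivity) (hb.1 hne)
    have heq : x = 1 / 2 → H (zeta x) (zeta (1 - x)) = zeta (1 / 2) := by
      rintro rfl
      rw [H_zeta hx, zeta_half, show (1 : ℝ) - 1 / 2 = 1 / 2 by norm_num, ← two_mul]
    refine ⟨?_, ?_, fun h => by_contra fun hne => (hstrict hne).ne' h, heq⟩
    · by_cases hne : x = 1 / 2
      · exact (heq hne).ge
      · exact (hstrict hne).le
    · rw [H_zeta hx, div_lt_iff₀ (by positivity)]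
      linarith
  · have hb := add_reflect_bounds strictConvexOn_inv_eta hx
    have hp1 := inv_pos.mpr (eta_pos hx.1)
    have hp2 := inv_pos.mpr (eta_pos (x := 1 - x) (by linarith [hx.2]))
    have hp3 := eta_pos half_mem.1
    rw [log_four_div, eta_half]
    have hlow : x ∈ Ioo (0 : ℝ) 1 → 2 / ((eta 0)⁻¹ + (eta 1)⁻¹) < H (eta x) (eta (1 - x)) :=
      fun hxo => by
        rw [H_eta hx]
        exact div_lt_div_of_pos_left two_pos (by positivity) (hb.2 hxo)
    have hend : x = 0 ∨ x = 1 → H (eta x) (eta (1 - x)) = 2 / ((eta 0)⁻¹ + (eta 1)⁻¹) := by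
      rw [H_eta hx]
      rintro (rfl | rfl)
      · rw [sub_zero]
      · rw [sub_self, add_comm]
    have hcases : (x = 0 ∨ x = 1) ∨ x ∈ Ioo (0 : ℝ) 1 := by
      rcases hx.1.eq_or_lt with h | h
      · exact .inl (.inl h.symm)
      rcases hx.2.eq_or_lt with h' | h'
      · exact .inl (.inr h')
      exact .inr ⟨h, h'⟩
    have hhalf : eta (1 / 2) = 2 / (2 * (eta (1 / 2))⁻¹) := by field_simp
    have hstrict : x ≠ 1 / 2 → H (eta x) (eta (1 - x)) < eta (1 / 2) := fun hne => by
      rw [H_eta hx, hhalf]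
      exact div_lt_div_of_pos_left two_pos (by positivity) (hb.1 hne)
    have heq : x = 1 / 2 → H (eta x) (eta (1 - x)) = eta (1 / 2) := by
      rintro rfl
      rw [H_eta hx, show (1 : ℝ) - 1 / 2 = 1 / 2 by norm_num, ← two_mul, ← hhalf]
    refine ⟨?_, ?_, ⟨fun h => ?_, hend⟩, fun h => by_contra fun hne => (hstrict hne).ne h, heq⟩
    · exact hcases.elim (fun h => (hend h).ge) fun h => (hlow h).le
    · by_cases hne : x = 1 / 2
      · exact (heq hne).le
      · exact (hstrict hne).le
    · exact hcases.elim id fun h' => absurd h (hlow h').ne'
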